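/- Consider the deterministic memoryless broadcast channel with input $X\in\{0,1,2,3\}$ and outputs $(Y_1,Y_2)=(0,0),(1,0),(1,1),(2,1)$ for $X=0,1,2,3$ respectively. Entropies are in bits. Auxiliary random variables $W,U,V$ take values in finite sets and $WUV-X-Y_1Y_2$ is a Markov chain. For $R_0,R_1,R_2\ge 0$ the Han--Costa inequalities for $(W,U,V,X)$ are $$R_0+R_1\le I(WU;Y_1),\qquad R_0+R_2\le I(WV;Y_2),$$ $$R_0+R_1+R_2\le \min\{I(W;Y_1),I(W;Y_2)\}+I(U;Y_1|W)+I(V;Y_2|W)-I(U;V|W).$$ A triple $(R_0,R_1,R_2)$ of non-negative rates is achievable if for all $\varepsilon,\lambda>0$ and all sufficiently large $n$ there is a length-$n$ code with a common message (for both receivers) and one private message for each receiver, independent and uniform on sets of sizes at least $2^{n(R_0-\varepsilon)}$, $2^{n(R_1-\varepsilon)}$, $2^{n(R_2-\varepsilon)}$, such that each receiver errs with probability at most $\lambda$. Then: 1. For some $W,U,V$ and uniform $X$, the triple $(1/2,1,1/2)$ satisfies the Han--Costa inequalities. 2. The triple $(1/2,1,1/2)$ is not achievable. Moreover, for all sufficiently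 small $\varepsilon>0$, the triple $(1/2-\varepsilon,1-\varepsilon,1/2-\varepsilon)$ satisfies the Han--Costa inequalities with strict inequality for some $W,U,V$ and uniform $X$, and is not achievable. 3. Every achievable triple with $R_0+R_1+R_2=2$ has $R_0=0$. 4. If $W-X-Y_1Y_2$ is a Markov chain with $W$ finite-valued and $R_0,R_1,R_2\ge0$ satisfy $R_0\le\min\{I(W;Y_1),I(W;Y_2)\}$, $R_0+R_1\le H(Y_1)$, $R_0+R_2\le H(Y_2)$, $R_0+R_1+R_2\le\min\{I(W;Y_1),I(W;Y_2)\}+H(Y_1Y_2|W)$ and $R_0+R_1+R_2=2$, then $X$ is uniform, $W$ is independent of $(Y_1,Y_2)$, and $R_0=0$. 5. If $R_0,R_1,R_2\ge0$ satisfy the Han--Costa inequalities for some $(W,U,V,X)$ and $R_0+R_1+R_2=2$, then $X$ is uniform and $W$ is independent of $(Y_1,Y_2)$. If in addition either (a) $R_0\le\min\{I(W;Y_1),I(W;Y_2)\}$ or (b) $2R_0+R_1+R_2\le I(WU;Y_1)+I(WV;Y_2)-I(U;V|W)$ holds, then $R_0=0$. 6. Consequently, no $(W,U,V,X)$, with any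 input distribution, satisfies the Han--Costa inequalities at $(1/2,1,1/2)$ together with (a), and none satisfies them together with (b). -/

import Mathlib

namespace BroadcastExample

/-! ### Finite random variables and Shannon information (in bits)

A finite probability space is a finite type `Ω` with a probability vector `p ∈ stdSimplex ℝ Ω`;
a random variable is a function on `Ω` with values in a finite type. -/

section Information

variable {Ω α β γ : Type*} [Fintype Ω] [Fintype α] [Fintype β] [Fintype γ]

open Classical in
/-- The probability `P(Z = z)`. -/
noncomputable def law (p : Ω → ℝ) (Z : Ω → α) (z : α) : ℝ :=
  ∑ ω with Z ω = z, p ω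

/-- The Shannon entropy `H(Z)` in bits. -/
noncomputable def entropy (p : Ω → ℝ) (Z : Ω → α) : ℝ :=
  ∑ z, Real.negMulLog (law p Z z) / Real.log 2

/-- The conditional entropy `H(A | C)`. -/
noncomputable def condEntropy (p : Ω → ℝ) (A : Ω → α) (C : Ω → γ) : ℝ :=
  entropy p (fun ω => (A ω, C ω)) - entropy p C

/-- The mutual information `I(A; B)`. -/
noncomputable def mutualInfo (p : Ω → ℝ) (A : Ω → α) (B : Ω → β) : ℝ :=
  entropy p A - condEntropy p A B

/-- The conditional mutual information `I(A; B | C)`. -/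
noncomputable def condMutualInfo (p : Ω → ℝ) (A : Ω → α) (B : Ω → β) (C : Ω → γ) : ℝ :=
  condEntropy p A C - condEntropy p A (fun ω => (B ω, C ω))

/-- `A` and `B` are independent. -/
def Independent (p : Ω → ℝ) (A : Ω → α) (B : Ω → β) : Prop :=
  ∀ a b, law p (fun ω => (A ω, B ω)) (a, b) = law p A a * law p B b

/-- `Z` is uniformly distributed on its alphabet. -/
def IsUniform (p : Ω → ℝ) (Z : Ω → α) : Prop :=
  ∀ z, law p Z z = 1 / (Fintype.card α : ℝ)

end Information

/-! ### Rate bounds for a deterministic broadcast channel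

The channel is a function `ch : 𝒳 → 𝒴₁ × 𝒴₂`. With input `X`, the outputs are
`Y₁ = (ch X).1` and `Y₂ = (ch X).2`; as they are functions of `X`, the chain
`WUV - X - Y₁Y₂` is Markov for every choice of `(W, U, V, X)`. -/

section Bounds

variable {Ω 𝒲 𝒰 𝒱 𝒳 𝒴₁ 𝒴₂ : Type*} [Fintype Ω] [Fintype 𝒲] [Fintype 𝒰] [Fintype 𝒱]
  [Fintype 𝒳] [Fintype 𝒴₁] [Fintype 𝒴₂]

/-- `I(WU; Y₁)`. -/
noncomputable def rhs₁ (ch : 𝒳 → 𝒴₁ × 𝒴₂) (p : Ω → ℝ) (W : Ω → 𝒲) (U : Ω → 𝒰)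
    (X : Ω → 𝒳) : ℝ :=
  mutualInfo p (fun ω => (W ω, U ω)) (fun ω => (ch (X ω)).1)

/-- `I(WV; Y₂)`. -/
noncomputable def rhs₂ (ch : 𝒳 → 𝒴₁ × 𝒴₂) (p : Ω → ℝ) (W : Ω → 𝒲) (V : Ω → 𝒱)
    (X : Ω → 𝒳) : ℝ :=
  mutualInfo p (fun ω => (W ω, V ω)) (fun ω => (ch (X ω)).2)

/-- `min {I(W; Y₁), I(W; Y₂)}`. -/
noncomputable def commonInfo (ch : 𝒳 → 𝒴₁ × 𝒴₂) (p : Ω → ℝ) (W : Ω → 𝒲) (X : Ω → 𝒳) : ℝ :=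
  min (mutualInfo p W (fun ω => (ch (X ω)).1)) (mutualInfo p W (fun ω => (ch (X ω)).2))

/-- `min {I(W; Y₁), I(W; Y₂)} + I(U; Y₁ | W) + I(V; Y₂ | W) - I(U; V | W)`. -/
noncomputable def rhs₃ (ch : 𝒳 → 𝒴₁ × 𝒴₂) (p : Ω → ℝ) (W : Ω → 𝒲) (U : Ω → 𝒰) (V : Ω → 𝒱)
    (X : Ω → 𝒳) : ℝ :=
  commonInfo ch p W X + condMutualInfo p U (fun ω => (ch (X ω)).1) W
    + condMutualInfo p V (fun ω => (ch (X ω)).2) W - condMutualInfo p U V W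

/-- `I(WU; Y₁) + I(WV; Y₂) - I(U; V | W)`. -/
noncomputable def rhs₄ (ch : 𝒳 → 𝒴₁ × 𝒴₂) (p : Ω → ℝ) (W : Ω → 𝒲) (U : Ω → 𝒰) (V : Ω → 𝒱)
    (X : Ω → 𝒳) : ℝ :=
  rhs₁ ch p W U X + rhs₂ ch p W V X - condMutualInfo p U V W

/-- The Han–Costa inequalities, non-strict form. -/
structure HanCosta (ch : 𝒳 → 𝒴₁ × 𝒴₂) (p : Ω → ℝ) (W : Ω → 𝒲) (U : Ω → 𝒰) (V : Ω → 𝒱)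
    (X : Ω → 𝒳) (R₀ R₁ R₂ : ℝ) : Prop where
  nonneg₀ : 0 ≤ R₀
  nonneg₁ : 0 ≤ R₁
  nonneg₂ : 0 ≤ R₂
  bound₁ : R₀ + R₁ ≤ rhs₁ ch p W U X
  bound₂ : R₀ + R₂ ≤ rhs₂ ch p W V X
  bound₃ : R₀ + R₁ + R₂ ≤ rhs₃ ch p W U V X

/-- The Han–Costa inequalities, strict form. -/
structure HanCostaStrict (ch : 𝒳 → 𝒴₁ × 𝒴₂) (p : Ω → ℝ) (W : Ω → 𝒲) (U : Ω → 𝒰)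
    (V : Ω → 𝒱) (X : Ω → 𝒳) (R₀ R₁ R₂ : ℝ) : Prop where
  nonneg₀ : 0 ≤ R₀
  nonneg₁ : 0 ≤ R₁
  nonneg₂ : 0 ≤ R₂
  bound₁ : R₀ + R₁ < rhs₁ ch p W U X
  bound₂ : R₀ + R₂ < rhs₂ ch p W V X
  bound₃ : R₀ + R₁ + R₂ < rhs₃ ch p W U V X

/-- The bounds whose union over `W - X - Y₁Y₂` is the single-letter description of the
capacity region of a deterministic broadcast channel. -/
structure DetBounds (ch : 𝒳 → 𝒴₁ × 𝒴₂) (p : Ω → ℝ) (W : Ω → 𝒲) (X : Ω → 𝒳)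
    (R₀ R₁ R₂ : ℝ) : Prop where
  nonneg₀ : 0 ≤ R₀
  nonneg₁ : 0 ≤ R₁
  nonneg₂ : 0 ≤ R₂
  bound₀ : R₀ ≤ commonInfo ch p W X
  bound₁ : R₀ + R₁ ≤ entropy p (fun ω => (ch (X ω)).1)
  bound₂ : R₀ + R₂ ≤ entropy p (fun ω => (ch (X ω)).2)
  bound₃ : R₀ + R₁ + R₂ ≤ commonInfo ch p W X + condEntropy p (fun ω => ch (X ω)) W

end Bounds

/-! ### Codes and achievable rate triples -/

section Codes

variable {𝒳 𝒴₁ 𝒴₂ : Type*}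

/-- A block code of length `n` with a common message in `Fin M₀` and private messages in
`Fin M₁`, `Fin M₂` for receivers 1 and 2. -/
structure Code (𝒳 𝒴₁ 𝒴₂ : Type*) (n M₀ M₁ M₂ : ℕ) where
  enc : Fin M₀ × Fin M₁ × Fin M₂ → Fin n → 𝒳
  dec₁ : (Fin n → 𝒴₁) → Fin M₀ × Fin M₁
  dec₂ : (Fin n → 𝒴₂) → Fin M₀ × Fin M₂

/-- Error probability of receiver 1 for uniformly distributed, independent messages, when the
code is used over the memoryless deterministic channel `ch`. -/
noncomputable def Code.err₁ {n M₀ M₁ M₂ : ℕ} (ch : 𝒳 → 𝒴₁ × 𝒴₂)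
    (c : Code 𝒳 𝒴₁ 𝒴₂ n M₀ M₁ M₂) : ℝ :=
  (Finset.univ.filter fun m : Fin M₀ × Fin M₁ × Fin M₂ =>
      c.dec₁ (fun i => (ch (c.enc m i)).1) ≠ (m.1, m.2.1)).card / ((M₀ * M₁ * M₂ : ℕ) : ℝ)

/-- Error probability of receiver 2. -/
noncomputable def Code.err₂ {n M₀ M₁ M₂ : ℕ} (ch : 𝒳 → 𝒴₁ × 𝒴₂)
    (c : Code 𝒳 𝒴₁ 𝒴₂ n M₀ M₁ M₂) : ℝ :=
  (Finset.univ.filter fun m : Fin M₀ × Fin M₁ × Fin M₂ =>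
      c.dec₂ (fun i => (ch (c.enc m i)).2) ≠ (m.1, m.2.2)).card / ((M₀ * M₁ * M₂ : ℕ) : ℝ)

/-- The rate triple `(R₀, R₁, R₂)` (bits per channel use) is achievable: for all `ε, lam > 0` and
all large `n` there is a length-`n` code whose message sets have at least `2 ^ (n (Rᵢ - ε))`
elements and whose two error probabilities are at most `lam`. -/
def Achievable (ch : 𝒳 → 𝒴₁ × 𝒴₂) (R₀ R₁ R₂ : ℝ) : Prop :=
  0 ≤ R₀ ∧ 0 ≤ R₁ ∧ 0 ≤ R₂ ∧
  ∀ ε : ℝ, 0 < ε → ∀ lam : ℝ, 0 < lam → ∀ᶠ n : ℕ in Filter.atTop,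
    ∃ (M₀ M₁ M₂ : ℕ) (c : Code 𝒳 𝒴₁ 𝒴₂ n M₀ M₁ M₂),
      (2 : ℝ) ^ ((n : ℝ) * (R₀ - ε)) ≤ (M₀ : ℝ) ∧
      (2 : ℝ) ^ ((n : ℝ) * (R₁ - ε)) ≤ (M₁ : ℝ) ∧
      (2 : ℝ) ^ ((n : ℝ) * (R₂ - ε)) ≤ (M₂ : ℝ) ∧
      c.err₁ ch ≤ lam ∧ c.err₂ ch ≤ lam

end Codes

/-- The channel `0 ↦ (0,0)`, `1 ↦ (1,0)`, `2 ↦ (1,1)`, `3 ↦ (2,1)`. -/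
def channel : Fin 4 → Fin 3 × Fin 2 := ![(0, 0), (1, 0), (1, 1), (2, 1)]

end BroadcastExample

namespace BroadcastExample

/-! Non-achievability does not go through a single-letter converse; it rests on hypercontractivity.
For uniform input, `E[f(Y₁) g(Y₂)] ≤ ‖f‖₂ ‖g‖_{3/2}` for `g ≥ 0`. Such a bound tensorizes, so output
events `A`, `B` of any block length satisfy `P(A ∩ B)^6 ≤ P(A)^3 P(B)^4`. The exponents `1/2 + 2/3 =
7/6` exceed 1: when the outputs are cut into many small cells, both receivers rarely land in cells
with the same label. A common message is such a labelling. Counting correctly decoded messages cell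
by cell (`sum_le_of_common_part`) gives `M^6 M₀ ≤ 4^(6n+7)` with `M = M₀M₁M₂` (`Code.card_bound`),
hence `7R₀ + 6R₁ + 6R₂ ≤ 12` (`Achievable.rate_bound`). At sum rate 2 this reads `R₀ ≤ 0`, and at
`(1/2, 1, 1/2)` the left side is `12.5`.

The single-letter statements come from `I(W;Yᵢ) + H(Y₁Y₂|W) ≤ H(X) ≤ 2`. Equality makes `X` uniform
and `W` conditionally independent of `X` given either output alone. The inputs form a chain 0-1-2-3
whose neighbours share an output, so `P(w, x)` does not depend on `x` and `W` is independent of `X`.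
Then `I(W;Yᵢ) ≤ 0`, and either extra bound forces `R₀ = 0`. The Han–Costa case reduces to this by
`binning_le_condEntropy`. -/

/-- The output sequence at receiver 1. -/
def out₁ {n : ℕ} (x : Fin n → Fin 4) : Fin n → Fin 3 := fun i => (channel (x i)).1

/-- The output sequence at receiver 2. -/
def out₂ {n : ℕ} (x : Fin n → Fin 4) : Fin n → Fin 2 := fun i => (channel (x i)).2

lemma channel_injective : Function.Injective channel := by
  decide

/-! ### A hypercontractive inequality for the channel -/

/-- The difference of the two sides is exactly the product in `h`. It vanishes to fourth order at `a
= b` because the exponent `3/2` is the smallest that the maximal correlation `1/√2` of `Y₁` and `Y₂`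
allows. -/
lemma two_point_inequality {a b : ℝ} (ha : 0 ≤ a) (hb : 0 ≤ b) :
    (3 * a ^ 4 + 2 * a ^ 2 * b ^ 2 + 3 * b ^ 4) ^ 3 ≤ 32 * (a ^ 3 + b ^ 3) ^ 4 := by
  have h : 0 ≤ (a - b) ^ 4 * (b ^ 4 * (b ^ 4 + (a ^ 2 - 2 * b ^ 2) ^ 2)
      + a ^ 4 * (a ^ 4 + (b ^ 2 - 2 * a ^ 2) ^ 2) + 20 * a * b ^ 7 + 12 * a ^ 3 * b ^ 5
      + 28 * a ^ 4 * b ^ 4 + 12 * a ^ 5 * b ^ 3 + 20 * a ^ 7 * b) := by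
    positivity
  linarith

/-- This is `E[f g] ≤ ‖f‖₂ ‖g‖_{3/2}` for uniform input, with `g = h²` and the sixth power taken to
clear the roots. Cauchy–Schwarz eliminates `f`; what remains is the two-point inequality for `h`. -/
lemma sum_channel_pow_le (f : Fin 3 → ℝ) (h : Fin 2 → ℝ) (hh : ∀ j, 0 ≤ h j) :
    4 * (∑ x, f (channel x).1 * h (channel x).2 ^ 2) ^ 6
      ≤ (∑ x, f (channel x).1 ^ 2) ^ 3 * (∑ x, h (channel x).2 ^ 3) ^ 4 := by
  have hch : channel = ![(0, 0), (1, 0), (1, 1), (2, 1)] := rfl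
  simp only [Fin.sum_univ_four, hch, Matrix.cons_val]
  have ha := hh 0
  have hb := hh 1
  generalize h 0 = a at *
  generalize h 1 = b at *
  generalize f 0 = u
  generalize f 1 = v
  generalize f 2 = w
  set A := u ^ 2 + v ^ 2 + v ^ 2 + w ^ 2
  set E := 3 * a ^ 4 + 2 * a ^ 2 * b ^ 2 + 3 * b ^ 4
  have hA : 0 ≤ A := by positivity
  have hE : 0 ≤ E := by positivity
  -- Cauchy–Schwarz for `(u, √2 v, w)` and `(a², (a² + b²)/√2, b²)`; the sum of squares below is the
  -- Lagrange remainder.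
  have h1 : 2 * (u * a ^ 2 + v * a ^ 2 + v * b ^ 2 + w * b ^ 2) ^ 2 ≤ A * E := by
    have : 0 ≤ (u * (a ^ 2 + b ^ 2) - 2 * v * a ^ 2) ^ 2
        + (w * (a ^ 2 + b ^ 2) - 2 * v * b ^ 2) ^ 2 + 2 * (u * b ^ 2 - w * a ^ 2) ^ 2 := by
      positivity
    simp only [A, E]
    linarith
  have h2 := pow_le_pow_left₀ (by positivity) h1 3
  have h3 := mul_le_mul_of_nonneg_left (two_point_inequality ha hb) (pow_nonneg hA 3)
  calc _ = (2 * (u * a ^ 2 + v * a ^ 2 + v * b ^ 2 + w * b ^ 2) ^ 2) ^ 3 / 2 := by ring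
    _ ≤ A ^ 3 * (32 * (a ^ 3 + b ^ 3) ^ 4) / 2 := by
      have h4 : (A * E) ^ 3 = A ^ 3 * E ^ 3 := mul_pow ..
      linarith
    _ = _ := by ring

lemma sum_out_succ {n : ℕ} (φ : (Fin (n + 1) → Fin 3) → (Fin (n + 1) → Fin 2) → ℝ) :
    ∑ x, φ (out₁ x) (out₂ x) = ∑ a, ∑ x : Fin n → Fin 4,
      φ (Fin.cons (channel a).1 (out₁ x)) (Fin.cons (channel a).2 (out₂ x)) := by
  rw [← Fintype.sum_prod_type', ← (Fin.consEquiv fun _ => Fin 4).sum_comp]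
  refine Finset.sum_congr rfl fun x _ => ?_
  congr 1 <;>
  · funext i
    refine Fin.cases ?_ (fun i => ?_) i <;> simp [out₁, out₂, Fin.consEquiv]

/-- Tensorization: with the first letter fixed, the induction hypothesis bounds the inner sum by
norms depending only on that letter's two outputs, and the one-letter inequality applies to these
norms. -/
lemma sum_out_pow_le {n : ℕ} (f : (Fin n → Fin 3) → ℝ) (h : (Fin n → Fin 2) → ℝ)
    (hf : ∀ y, 0 ≤ f y) (hh : ∀ z, 0 ≤ h z) :
    4 ^ n * (∑ x, f (out₁ x) * h (out₂ x) ^ 2) ^ 6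
      ≤ (∑ x, f (out₁ x) ^ 2) ^ 3 * (∑ x, h (out₂ x) ^ 3) ^ 4 := by
  induction n with
  | zero =>
    rw [Fintype.sum_unique, Fintype.sum_unique, Fintype.sum_unique]
    apply le_of_eq
    ring
  | succ n ih =>
    have e1 := sum_out_succ (n := n) fun y z => f y * h z ^ 2
    have e2 := sum_out_succ (n := n) fun y _ => f y ^ 2
    have e3 := sum_out_succ (n := n) fun _ z => h z ^ 3
    beta_reduce at e1 e2 e3
    rw [e1, e2, e3]
    set N : Fin 3 → Fin 2 → ℝ := fun i j =>
      ∑ x : Fin n → Fin 4, f (Fin.cons i (out₁ x)) * h (Fin.cons j (out₂ x)) ^ 2 with hN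
    set A : Fin 3 → ℝ := fun i => ∑ x : Fin n → Fin 4, f (Fin.cons i (out₁ x)) ^ 2 with hA
    set B : Fin 2 → ℝ := fun j => ∑ x : Fin n → Fin 4, h (Fin.cons j (out₂ x)) ^ 3 with hB
    have hN0 : ∀ i j, 0 ≤ N i j := fun i j =>
      Finset.sum_nonneg fun x _ => mul_nonneg (hf _) (pow_nonneg (hh _) 2)
    have hA0 : ∀ i, 0 ≤ A i := fun i => Finset.sum_nonneg fun x _ => sq_nonneg _
    have hB0 : ∀ j, 0 ≤ B j := fun j => Finset.sum_nonneg fun x _ => pow_nonneg (hh _) 3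
    have key : ∀ i j, 4 ^ n * N i j ^ 6 ≤ A i ^ 3 * B j ^ 4 := fun i j =>
      ih (fun y => f (Fin.cons i y)) (fun z => h (Fin.cons j z)) (fun _ => hf _) fun _ => hh _
    have root : ∀ (r : ℝ) (k : ℕ), 0 ≤ r → k ≠ 0 → ∃ s : ℝ, 0 ≤ s ∧ s ^ k = r :=
      fun r k hr hk => ⟨r ^ ((k : ℝ)⁻¹), Real.rpow_nonneg hr _, Real.rpow_inv_natCast_pow hr hk⟩
    -- `F i` is the 2-norm of the slice of `f` at `i`, `H j` the 3-norm of the slice of `h` at `j`;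
    -- `c` absorbs the factor `4 ^ n`.
    choose F hF0 hF using fun i => root (A i) 2 (hA0 i) two_ne_zero
    choose H hH0 hH using fun j => root (B j) 3 (hB0 j) three_ne_zero
    obtain ⟨c, hc0, hc⟩ := root (4 ^ n) 6 (by positivity) (by norm_num)
    have hle : ∀ i j, c * N i j ≤ F i * H j ^ 2 := fun i j => by
      refine le_of_pow_le_pow_left₀ (n := 6) (by norm_num)
        (mul_nonneg (hF0 i) (pow_nonneg (hH0 j) 2)) ?_
      calc (c * N i j) ^ 6 = 4 ^ n * N i j ^ 6 := by rw [mul_pow, hc]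
        _ ≤ A i ^ 3 * B j ^ 4 := key i j
        _ = _ := by rw [← hF, ← hH]; ring
    have hsum : c * ∑ a, N (channel a).1 (channel a).2
        ≤ ∑ a, F (channel a).1 * H (channel a).2 ^ 2 := by
      rw [Finset.mul_sum]
      exact Finset.sum_le_sum fun a _ => hle _ _
    have hpow := pow_le_pow_left₀
      (mul_nonneg hc0 (Finset.sum_nonneg fun a _ => hN0 _ _)) hsum 6
    have hone := sum_channel_pow_le F H hH0
    simp only [hF, hH] at hone
    rw [mul_pow, hc] at hpow
    rw [pow_succ]
    linarith

/-- Pairs of disjoint families of output events capture few input sequences, unless one of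
the events captures many. -/
lemma sum_le_of_common_part {n : ℕ} {ι : Type*} [Fintype ι] [DecidableEq ι]
    (d₁ : (Fin n → Fin 3) → ι) (d₂ : (Fin n → Fin 2) → ι) (s : ι → ℝ) {K τ : ℝ}
    (hs : ∀ k, 0 ≤ s k)
    (hN : ∀ k, s k ≤ ∑ x, if d₁ (out₁ x) = k ∧ d₂ (out₂ x) = k then (1 : ℝ) else 0)
    (hK : ∀ k, s k ≤ K) (hK0 : 0 ≤ K) (hτ : 0 < τ) :
    ∑ k, s k ≤ K / τ ^ 6 + τ * 4 ^ n := by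
  set a : ι → ℝ := fun k => ∑ x, if d₁ (out₁ x) = k then (1 : ℝ) else 0 with ha
  set b : ι → ℝ := fun k => ∑ x, if d₂ (out₂ x) = k then (1 : ℝ) else 0 with hb
  have hasum : ∑ k, a k = 4 ^ n := by
    simp only [ha]
    rw [Finset.sum_comm]
    simp
  have hbsum : ∑ k, b k = 4 ^ n := by
    simp only [hb]
    rw [Finset.sum_comm]
    simp
  have ha0 : ∀ k, 0 ≤ a k := fun k => Finset.sum_nonneg fun x _ => by positivity
  have hb0 : ∀ k, 0 ≤ b k := fun k => Finset.sum_nonneg fun x _ => by positivity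
  have h4 : (0 : ℝ) < 4 ^ n := by positivity
  have hyper : ∀ k, 4 ^ n * s k ^ 6 ≤ a k ^ 3 * b k ^ 4 := fun k => by
    have h := sum_out_pow_le (n := n) (fun y => if d₁ y = k then 1 else 0)
      (fun z => if d₂ z = k then 1 else 0) (fun _ => by positivity) (fun _ => by positivity)
    simp only [ite_pow, one_pow, ne_eq, OfNat.ofNat_ne_zero, not_false_eq_true, zero_pow,
      ← ite_and, mul_ite, mul_one, mul_zero] at h
    refine le_trans (mul_le_mul_of_nonneg_left (pow_le_pow_left₀ (hs k) ?_ 6) h4.le) h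
    refine (hN k).trans (le_of_eq (Finset.sum_congr rfl fun x _ => ?_))
    split_ifs <;> tauto
  -- A cell with `b k ≥ τ^6 4^n` is charged the trivial bound `K`; there are at most `τ^(-6)` of
  -- these. In a smaller cell, `hyper` and AM–GM give `s k ≤ τ √(a k * b k) ≤ τ (a k + b k) / 2`.
  have hterm : ∀ k, s k ≤ K / τ ^ 6 * (b k / 4 ^ n) + τ * ((a k + b k) / 2) := fun k => by
    have hp1 : 0 ≤ τ * ((a k + b k) / 2) :=
      mul_nonneg hτ.le (div_nonneg (add_nonneg (ha0 k) (hb0 k)) two_pos.le)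
    have hp2 : 0 ≤ K / τ ^ 6 * (b k / 4 ^ n) :=
      mul_nonneg (div_nonneg hK0 (by positivity)) (div_nonneg (hb0 k) h4.le)
    rcases le_total (τ ^ 6 * 4 ^ n) (b k) with hbig | hsmall
    · have : K ≤ K / τ ^ 6 * (b k / 4 ^ n) := by
        rw [div_mul_div_comm, le_div_iff₀ (by positivity)]
        exact mul_le_mul_of_nonneg_left hbig hK0
      linarith [hK k]
    · have : s k ≤ τ * ((a k + b k) / 2) := by
        refine le_of_pow_le_pow_left₀ (n := 6) (by norm_num) hp1 ?_
        have hab : a k * b k ≤ ((a k + b k) / 2) ^ 2 := by nlinarith [sq_nonneg (a k - b k)]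
        have h1 : 4 ^ n * s k ^ 6 ≤ 4 ^ n * (τ ^ 6 * (a k * b k) ^ 3) :=
          calc 4 ^ n * s k ^ 6 ≤ a k ^ 3 * b k ^ 4 := hyper k
            _ = (a k * b k) ^ 3 * b k := by ring
            _ ≤ (a k * b k) ^ 3 * (τ ^ 6 * 4 ^ n) :=
              mul_le_mul_of_nonneg_left hsmall (pow_nonneg (mul_nonneg (ha0 k) (hb0 k)) 3)
            _ = _ := by ring
        calc s k ^ 6 ≤ τ ^ 6 * (a k * b k) ^ 3 := le_of_mul_le_mul_left h1 h4
          _ ≤ τ ^ 6 * (((a k + b k) / 2) ^ 2) ^ 3 := by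
            gcongr
          _ = _ := by ring
      linarith
  calc ∑ k, s k ≤ ∑ k, (K / τ ^ 6 * (b k / 4 ^ n) + τ * ((a k + b k) / 2)) :=
        Finset.sum_le_sum fun k _ => hterm k
    _ = K / τ ^ 6 * ((∑ k, b k) / 4 ^ n) + τ * ((∑ k, a k + ∑ k, b k) / 2) := by
        rw [Finset.sum_add_distrib, ← Finset.mul_sum, ← Finset.mul_sum, ← Finset.sum_div,
          ← Finset.sum_div, Finset.sum_add_distrib]
    _ = _ := by
        rw [hasum, hbsum]
        have hdiv : (4 : ℝ) ^ n / 4 ^ n = 1 := div_self h4.ne'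
        rw [hdiv]
        ring

/-! ### The converse for block codes -/

lemma Code.card_bound {n M₀ M₁ M₂ : ℕ} (c : Code (Fin 4) (Fin 3) (Fin 2) n M₀ M₁ M₂)
    (h₀ : 0 < M₀) (h₁ : 0 < M₁) (h₂ : 0 < M₂)
    (he₁ : c.err₁ channel ≤ 1 / 4) (he₂ : c.err₂ channel ≤ 1 / 4) :
    ((M₀ * M₁ * M₂ : ℕ) : ℝ) ^ 6 * M₀ ≤ 4 ^ (6 * n + 7) := by
  set M : ℝ := ((M₀ * M₁ * M₂ : ℕ) : ℝ) with hM
  have hMpos : 0 < M := by rw [hM]; positivity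
  set bad₁ := Finset.univ.filter fun m : Fin M₀ × Fin M₁ × Fin M₂ =>
      c.dec₁ (fun i => (channel (c.enc m i)).1) ≠ (m.1, m.2.1) with hbad₁
  set bad₂ := Finset.univ.filter fun m : Fin M₀ × Fin M₁ × Fin M₂ =>
      c.dec₂ (fun i => (channel (c.enc m i)).2) ≠ (m.1, m.2.2) with hbad₂
  set good := Finset.univ.filter fun m : Fin M₀ × Fin M₁ × Fin M₂ =>
      c.dec₁ (out₁ (c.enc m)) = (m.1, m.2.1) ∧ c.dec₂ (out₂ (c.enc m)) = (m.1, m.2.2) with hgood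
  have hb₁ : (bad₁.card : ℝ) ≤ 1 / 4 * M := (div_le_iff₀ hMpos).1 he₁
  have hb₂ : (bad₂.card : ℝ) ≤ 1 / 4 * M := (div_le_iff₀ hMpos).1 he₂
  have hcover : M ≤ good.card + bad₁.card + bad₂.card := by
    have hsub : (Finset.univ : Finset (Fin M₀ × Fin M₁ × Fin M₂)) ⊆ (good ∪ bad₁) ∪ bad₂ := by
      intro m _
      simp only [hgood, hbad₁, hbad₂, Finset.mem_union, Finset.mem_filter, Finset.mem_univ,
        true_and]
      exact (em _).elim (fun h₁ => (em _).elim (fun h₂ => .inl (.inl ⟨h₁, h₂⟩)) .inr)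
        fun h₁ => .inl (.inr h₁)
    have hcard := (Finset.card_le_card hsub).trans (Finset.card_union_le _ _)
    have hcard' := Finset.card_union_le good bad₁
    have huniv : (Finset.univ : Finset (Fin M₀ × Fin M₁ × Fin M₂)).card = M₀ * M₁ * M₂ := by
      simp [mul_assoc]
    rw [hM]
    exact_mod_cast (show M₀ * M₁ * M₂ ≤ good.card + bad₁.card + bad₂.card by omega)
  have hinj : Set.InjOn c.enc good := by
    intro m hm m' hm' heq
    simp only [hgood, Finset.coe_filter, Finset.mem_univ, true_and, Set.mem_ofPred_eq] at hm hm'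
    have e₁ := hm.1.symm.trans ((congrArg (fun x => c.dec₁ (out₁ x)) heq).trans hm'.1)
    have e₂ := hm.2.symm.trans ((congrArg (fun x => c.dec₂ (out₂ x)) heq).trans hm'.2)
    simp only [Prod.mk.injEq] at e₁ e₂
    exact Prod.ext e₁.1 (Prod.ext e₁.2 e₂.2)
  -- At least `M / 2` messages are good. This `τ` makes the large cells account for at most `M₁M₂ /
  -- τ^6 = M / 4`, so the other term must supply `M / 4`.
  obtain ⟨τ, hτ, hτ6⟩ : ∃ τ : ℝ, 0 < τ ∧ τ ^ 6 = 4 / M₀ :=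
    ⟨(4 / M₀ : ℝ) ^ (((6 : ℕ) : ℝ)⁻¹), Real.rpow_pos_of_pos (by positivity) _,
      Real.rpow_inv_natCast_pow (by positivity) (by norm_num)⟩
  have hsum := sum_le_of_common_part (n := n) (fun y => (c.dec₁ y).1) (fun z => (c.dec₂ z).1)
    (fun k => ((good.filter fun m => m.1 = k).card : ℝ)) (K := (M₁ * M₂ : ℕ)) (τ := τ)
    (fun k => by positivity)
    (fun k => by
      rw [Finset.sum_boole]
      refine Nat.cast_le.2 (Finset.card_le_card_of_injOn c.enc (fun m hm => ?_)
        (hinj.mono fun m hm => (Finset.mem_filter.1 hm).1))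
      simp only [hgood, Finset.coe_filter, Finset.mem_filter, Finset.mem_univ, true_and,
        Set.mem_ofPred_eq] at hm
      simp [hm.1.1, hm.1.2, hm.2])
    (fun k => by
      have : (good.filter fun m => m.1 = k).card
          ≤ (Finset.univ : Finset (Fin M₁ × Fin M₂)).card := by
        refine Finset.card_le_card_of_injOn Prod.snd
          (fun _ _ => Finset.mem_coe.2 (Finset.mem_univ _)) ?_
        intro m hm m' hm' heq
        exact Prod.ext ((Finset.mem_filter.1 hm).2.trans (Finset.mem_filter.1 hm').2.symm) heq
      exact_mod_cast this.trans (by simp))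
    (by positivity) hτ
  have hgoodsum : ∑ k, ((good.filter fun m => m.1 = k).card : ℝ) = good.card := by
    rw [← Nat.cast_sum]
    exact congrArg _ (Finset.card_eq_sum_card_fiberwise fun _ _ =>
      Finset.mem_coe.2 (Finset.mem_univ _)).symm
  have hK : ((M₁ * M₂ : ℕ) : ℝ) / τ ^ 6 = M / 4 := by
    rw [hτ6, hM]
    push_cast
    field_simp
  rw [hgoodsum, hK] at hsum
  have hfin : M ≤ 4 * (τ * 4 ^ n) := by linarith
  have hM₀ : (0 : ℝ) < M₀ := Nat.cast_pos.2 h₀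
  calc M ^ 6 * M₀ ≤ (4 * (τ * 4 ^ n)) ^ 6 * M₀ := by gcongr
    _ = 4 ^ 6 * (τ ^ 6 * M₀) * 4 ^ (6 * n) := by ring
    _ = 4 ^ (6 * n + 7) := by
      rw [hτ6, div_mul_cancel₀ _ hM₀.ne']
      ring

lemma Achievable.rate_bound {R₀ R₁ R₂ : ℝ} (h : Achievable channel R₀ R₁ R₂) :
    7 * R₀ + 6 * R₁ + 6 * R₂ ≤ 12 := by
  obtain ⟨-, -, -, h⟩ := h
  by_contra! hlt
  set η := 7 * R₀ + 6 * R₁ + 6 * R₂ - 12 with hη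
  have hη0 : 0 < η := by linarith
  -- The slack enters `7 + 6 + 6 = 19` times, costing `η / 2`; then `n > 28 / η` makes the remaining
  -- `n η / 2` exceed the 14 bits of `4 ^ 7`.
  obtain ⟨n, ⟨M₀, M₁, M₂, c, h₀, h₁, h₂, he₁, he₂⟩, hn⟩ :=
    ((h (η / 38) (by positivity) (1 / 4) (by norm_num)).and
      (Filter.eventually_gt_atTop ⌈28 / η⌉₊)).exists
  have two : (0 : ℝ) < 2 := two_pos
  have pos : ∀ {M : ℕ} {r : ℝ}, (2 : ℝ) ^ r ≤ M → 0 < M := fun hr =>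
    Nat.cast_pos.1 ((Real.rpow_pos_of_pos two _).trans_le hr)
  have hb := c.card_bound (pos h₀) (pos h₁) (pos h₂) he₁ he₂
  have hlow : (2 : ℝ) ^ ((n : ℝ) * (12 + η / 2)) ≤ ((M₀ * M₁ * M₂ : ℕ) : ℝ) ^ 6 * M₀ := by
    calc (2 : ℝ) ^ ((n : ℝ) * (12 + η / 2))
        = (2 ^ ((n : ℝ) * (R₀ - η / 38)) * 2 ^ ((n : ℝ) * (R₁ - η / 38))
          * 2 ^ ((n : ℝ) * (R₂ - η / 38))) ^ 6 * 2 ^ ((n : ℝ) * (R₀ - η / 38)) := by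
          rw [← Real.rpow_add two, ← Real.rpow_add two, ← Real.rpow_mul_natCast two.le,
            ← Real.rpow_add two]
          congr 1
          rw [hη]
          push_cast
          ring
      _ ≤ ((M₀ : ℝ) * M₁ * M₂) ^ 6 * M₀ := by gcongr
      _ = _ := by push_cast; rfl
  have hup : (4 : ℝ) ^ (6 * n + 7) = 2 ^ ((12 * n + 14 : ℝ)) := by
    rw [show (4 : ℝ) = 2 ^ 2 by norm_num, ← pow_mul, ← Real.rpow_natCast]
    congr 1
    push_cast
    ring
  have hexp := (Real.rpow_le_rpow_left_iff one_lt_two).1 ((hlow.trans hb).trans_eq hup)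
  have hn' : 28 / η < n := Nat.lt_of_ceil_lt hn
  rw [div_lt_iff₀ hη0] at hn'
  linarith

/-! ### Entropy inequalities -/

section Law

variable {Ω α β : Type*} [Fintype Ω] {p : Ω → ℝ}

lemma law_nonneg (hp : ∀ ω, 0 ≤ p ω) (Z : Ω → α) (z : α) : 0 ≤ law p Z z :=
  Finset.sum_nonneg fun ω _ => hp ω

lemma le_law (hp : ∀ ω, 0 ≤ p ω) (Z : Ω → α) (ω : Ω) : p ω ≤ law p Z (Z ω) := by
  classical
  exact Finset.single_le_sum (fun ω _ => hp ω) (Finset.mem_filter.2 ⟨Finset.mem_univ ω, rfl⟩)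

lemma law_mono (hp : ∀ ω, 0 ≤ p ω) {Z : Ω → α} {Z' : Ω → β} {z : α} {z' : β}
    (h : ∀ ω, Z ω = z → Z' ω = z') : law p Z z ≤ law p Z' z' := by
  classical
  exact Finset.sum_le_sum_of_subset_of_nonneg
    (fun ω hω => Finset.mem_filter.2 ⟨Finset.mem_univ ω, h ω (Finset.mem_filter.1 hω).2⟩)
    fun ω _ _ => hp ω

lemma law_congr {Z : Ω → α} {Z' : Ω → β} {z : α} {z' : β}
    (h : ∀ ω, Z ω = z ↔ Z' ω = z') : law p Z z = law p Z' z' := by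
  classical
  exact Finset.sum_congr (Finset.filter_congr fun ω _ => h ω) fun _ _ => rfl

lemma law_eq_zero {Z : Ω → α} {z : α} (h : ∀ ω, Z ω ≠ z) : law p Z z = 0 := by
  classical
  exact Finset.sum_eq_zero fun ω hω => absurd (Finset.mem_filter.1 hω).2 (h ω)

lemma sum_law_mul [Fintype α] (p : Ω → ℝ) (Z : Ω → α) (φ : α → ℝ) :
    ∑ z, law p Z z * φ z = ∑ ω, p ω * φ (Z ω) := by
  classical
  simp only [law, Finset.sum_filter, Finset.sum_mul]
  rw [Finset.sum_comm]
  simp [ite_mul]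

lemma sum_law [Fintype α] (p : Ω → ℝ) (Z : Ω → α) : ∑ z, law p Z z = ∑ ω, p ω := by
  simpa using sum_law_mul p Z fun _ => 1

lemma sum_law_pair [Fintype α] (p : Ω → ℝ) (A : Ω → α) (B : Ω → β) (b : β) :
    ∑ a, law p (fun ω => (A ω, B ω)) (a, b) = law p B b := by
  classical
  simp only [law, Finset.sum_filter, Prod.mk.injEq]
  rw [Finset.sum_comm]
  simp [ite_and]

end Law

section Entropy

variable {Ω α β γ : Type*} [Fintype Ω] [Fintype α] [Fintype β] [Fintype γ] {p : Ω → ℝ}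

/-- Summing over sample points puts entropies of variables with different alphabets under one sum,
where they compare term by term. -/
lemma entropy_eq_sum (p : Ω → ℝ) (Z : Ω → α) :
    entropy p Z = -(∑ ω, p ω * Real.log (law p Z (Z ω))) / Real.log 2 := by
  rw [← sum_law_mul p Z fun z => Real.log (law p Z z), entropy, ← Finset.sum_div,
    ← Finset.sum_neg_distrib]
  simp only [Real.negMulLog, neg_mul]

/-- Entropy depends only on the partition of `Ω` into level sets; this serves to permute tuples and
drop determined coordinates. -/
lemma entropy_congr {Z : Ω → α} {Z' : Ω → β} (h : ∀ ω ω', Z ω = Z ω' ↔ Z' ω = Z' ω') :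
    entropy p Z = entropy p Z' := by
  rw [entropy_eq_sum, entropy_eq_sum]
  simp only [law_congr fun ω' => h ω' _]

lemma log_two_pos : 0 < Real.log 2 := Real.log_pos one_lt_two

lemma entropy_le_of_determines (hp : ∀ ω, 0 ≤ p ω) {Z : Ω → α} {Z' : Ω → β}
    (h : ∀ ω ω', Z ω = Z ω' → Z' ω = Z' ω') : entropy p Z' ≤ entropy p Z := by
  rw [entropy_eq_sum, entropy_eq_sum]
  refine div_le_div_of_nonneg_right (neg_le_neg (Finset.sum_le_sum fun ω _ => ?_))
    log_two_pos.le
  rcases (hp ω).eq_or_lt with h0 | h0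
  · simp [← h0]
  · exact mul_le_mul_of_nonneg_left (Real.log_le_log (h0.trans_le (le_law hp Z ω))
      (law_mono hp fun ω' h' => h ω' ω h')) h0.le

lemma sub_le_mul_log_sub {q r : ℝ} (hq : 0 ≤ q) (hr : 0 ≤ r) (h : r = 0 → q = 0) :
    q - r ≤ q * (Real.log q - Real.log r) ∧
      (q * (Real.log q - Real.log r) ≤ q - r → q = r) := by
  rcases hq.eq_or_lt with rfl | hq
  · exact ⟨by simpa using hr, fun h => by linarith⟩
  have hr : 0 < r := hr.lt_of_ne fun h0 => hq.ne' (h h0.symm)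
  have hlog : q * (Real.log q - Real.log r) = -(q * Real.log (r / q)) := by
    rw [Real.log_div hr.ne' hq.ne']
    ring
  have hmul : q * (r / q - 1) = r - q := by field_simp
  rw [hlog]
  constructor
  · have := mul_le_mul_of_nonneg_left (Real.log_le_sub_one_of_pos (div_pos hr hq)) hq.le
    linarith
  · intro hle
    by_contra hne
    have := mul_lt_mul_of_pos_left (Real.log_lt_sub_one_of_pos (div_pos hr hq)
      fun h1 => hne ((div_eq_one_iff_eq hq.ne').1 h1).symm) hq
    linarith

/-- Gibbs' inequality, with its equality case. -/
lemma gibbs {ι : Type*} [Fintype ι] {q r : ι → ℝ} (hq : ∀ i, 0 ≤ q i) (hr : ∀ i, 0 ≤ r i)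
    (h : ∀ i, r i = 0 → q i = 0) (hsum : ∑ i, r i ≤ ∑ i, q i) :
    0 ≤ ∑ i, q i * (Real.log (q i) - Real.log (r i)) ∧
      (∑ i, q i * (Real.log (q i) - Real.log (r i)) ≤ 0 → ∀ i, q i = r i) := by
  have hle := fun i => (sub_le_mul_log_sub (hq i) (hr i) (h i)).1
  have hsub : 0 ≤ ∑ i, (q i - r i) := by
    rw [Finset.sum_sub_distrib]
    linarith
  refine ⟨hsub.trans (Finset.sum_le_sum fun i _ => hle i), fun h0 i => ?_⟩
  refine (sub_le_mul_log_sub (hq i) (hr i) (h i)).2 (le_of_eq ?_)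
  exact ((Finset.sum_eq_sum_iff_of_le fun i _ => hle i).1
    (le_antisymm (Finset.sum_le_sum fun i _ => hle i) (h0.trans hsub)) i (Finset.mem_univ i)).symm

lemma entropy_le_log_card (hp : ∀ ω, 0 ≤ p ω) (hp1 : ∑ ω, p ω = 1) (Z : Ω → α) :
    entropy p Z ≤ Real.log (Fintype.card α) / Real.log 2 ∧
      (Real.log (Fintype.card α) / Real.log 2 ≤ entropy p Z → IsUniform p Z) := by
  have hsum : ∑ z, law p Z z = 1 := (sum_law p Z).trans hp1
  have hne : Nonempty α := by
    by_contra hne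
    rw [not_nonempty_iff] at hne
    simp at hsum
  have hcard : (0 : ℝ) < Fintype.card α := Nat.cast_pos.2 Fintype.card_pos
  obtain ⟨h1, h2⟩ := gibbs (q := law p Z) (r := fun _ => 1 / (Fintype.card α : ℝ))
    (law_nonneg hp Z) (fun _ => by positivity) (fun _ h => absurd h (by positivity))
    (by rw [hsum]; simp)
  have hE : ∑ z, law p Z z * (Real.log (law p Z z) - Real.log (1 / (Fintype.card α : ℝ)))
      = Real.log (Fintype.card α) - entropy p Z * Real.log 2 := by
    simp only [one_div, Real.log_inv, sub_neg_eq_add, mul_add]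
    rw [Finset.sum_add_distrib, ← Finset.sum_mul, hsum, sum_law_mul p Z, entropy_eq_sum,
      div_mul_cancel₀ _ log_two_pos.ne']
    ring
  rw [hE] at h1 h2
  rw [le_div_iff₀ log_two_pos, div_le_iff₀ log_two_pos]
  exact ⟨by linarith, fun h z => h2 (by linarith) z⟩

/-- Submodularity of entropy; equality means conditional independence. -/
lemma entropy_submodular (hp : ∀ ω, 0 ≤ p ω) (A : Ω → α) (B : Ω → β) (C : Ω → γ) :
    entropy p (fun ω => (A ω, B ω, C ω)) + entropy p C
        ≤ entropy p (fun ω => (A ω, C ω)) + entropy p (fun ω => (B ω, C ω)) ∧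
      (entropy p (fun ω => (A ω, C ω)) + entropy p (fun ω => (B ω, C ω))
          ≤ entropy p (fun ω => (A ω, B ω, C ω)) + entropy p C →
        ∀ a b c, law p (fun ω => (A ω, B ω, C ω)) (a, b, c) * law p C c
          = law p (fun ω => (A ω, C ω)) (a, c) * law p (fun ω => (B ω, C ω)) (b, c)) := by
  set ABC := fun ω => (A ω, B ω, C ω) with hABC
  set AC := fun ω => (A ω, C ω) with hAC
  set BC := fun ω => (B ω, C ω) with hBC
  have hleAC : ∀ a b c, law p ABC (a, b, c) ≤ law p AC (a, c) := fun a b c =>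
    law_mono hp fun ω h => by
      simp only [hABC, hAC, Prod.mk.injEq] at h ⊢
      exact ⟨h.1, h.2.2⟩
  have hleBC : ∀ a b c, law p ABC (a, b, c) ≤ law p BC (b, c) := fun a b c =>
    law_mono hp fun ω h => by
      simp only [hABC, hBC, Prod.mk.injEq] at h ⊢
      exact h.2
  have hleC : ∀ b c, law p BC (b, c) ≤ law p C c := fun b c =>
    law_mono hp fun ω h => by
      simp only [hBC, Prod.mk.injEq] at h
      exact h.2
  -- The law making `A` and `B` conditionally independent given `C`; where `C` has no mass, division
  -- by zero gives the correct value 0.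
  set r : α × β × γ → ℝ := fun z => law p AC (z.1, z.2.2) * law p BC z.2 / law p C z.2.2 with hr
  have hr0 : ∀ z, 0 ≤ r z := fun z =>
    div_nonneg (mul_nonneg (law_nonneg hp _ _) (law_nonneg hp _ _)) (law_nonneg hp _ _)
  have hq0 := law_nonneg hp ABC
  have habs : ∀ z, r z = 0 → law p ABC z = 0 := by
    rintro ⟨a, b, c⟩ h
    refine le_antisymm ?_ (hq0 _)
    rcases div_eq_zero_iff.1 h with h | h
    · rcases mul_eq_zero.1 h with h | h
      · exact (hleAC a b c).trans h.le
      · exact (hleBC a b c).trans h.le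
    · exact (hleBC a b c).trans ((hleC b c).trans h.le)
  have hsum : ∑ z, r z ≤ ∑ z, law p ABC z := by
    refine le_of_eq ?_
    rw [sum_law, ← sum_law p C]
    simp only [hr, Fintype.sum_prod_type_right, ← Finset.sum_div, ← Finset.sum_mul,
      ← Finset.mul_sum]
    refine Finset.sum_congr rfl fun c _ => ?_
    rw [sum_law_pair p A C c, sum_law_pair p B C c,
      mul_self_div_self]
  obtain ⟨h1, h2⟩ := gibbs hq0 hr0 habs hsum
  have hE : ∑ z, law p ABC z * (Real.log (law p ABC z) - Real.log (r z))
      = (entropy p AC + entropy p BC - (entropy p ABC + entropy p C)) * Real.log 2 := by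
    rw [sum_law_mul p ABC fun z => Real.log (law p ABC z) - Real.log (r z)]
    simp only [entropy_eq_sum, ← add_div, ← sub_div, div_mul_cancel₀ _ log_two_pos.ne']
    simp only [← Finset.sum_neg_distrib, ← Finset.sum_add_distrib, ← Finset.sum_sub_distrib]
    refine Finset.sum_congr rfl fun ω _ => ?_
    rcases (hp ω).eq_or_lt with h0 | h0
    · simp [← h0]
    · have hA : law p AC (A ω, C ω) ≠ 0 := (h0.trans_le (le_law hp AC ω)).ne'
      have hB : law p BC (B ω, C ω) ≠ 0 := (h0.trans_le (le_law hp BC ω)).ne'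
      have hC : law p C (C ω) ≠ 0 := (h0.trans_le (le_law hp C ω)).ne'
      simp only [hr, hABC, hAC, hBC] at hA hB ⊢
      rw [Real.log_div (mul_ne_zero hA hB) hC, Real.log_mul hA hB]
      ring
  rw [hE] at h1 h2
  constructor
  · have := nonneg_of_mul_nonneg_left h1 log_two_pos
    linarith
  · intro hle a b c
    have := h2 (mul_nonpos_of_nonpos_of_nonneg (by linarith) log_two_pos.le) (a, b, c)
    rw [this]
    rcases eq_or_ne (law p C c) 0 with hc | hc
    · have hb : law p BC (b, c) = 0 := le_antisymm ((hleC b c).trans hc.le) (law_nonneg hp _ _)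
      rw [hc, hb]
      simp
    · exact div_mul_cancel₀ _ hc

lemma Independent.entropy_pair (hp1 : ∑ ω, p ω = 1) {A : Ω → α} {B : Ω → β}
    (h : Independent p A B) : entropy p (fun ω => (A ω, B ω)) = entropy p A + entropy p B := by
  simp only [entropy, ← Finset.sum_div, ← add_div]
  congr 1
  have hA := (sum_law p A).trans hp1
  have hB := (sum_law p B).trans hp1
  rw [Fintype.sum_prod_type]
  simp only [h _ _, Real.negMulLog_mul, Finset.sum_add_distrib, ← Finset.sum_mul,
    ← Finset.mul_sum, hA, hB, one_mul]

end Entropy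

/-! ### Consequences of sum rate 2 -/

section SumRate

variable {Ω 𝒲 𝒰 𝒱 : Type*} [Fintype Ω] [Fintype 𝒲] [Fintype 𝒰] [Fintype 𝒱] {p : Ω → ℝ}

lemma entropy_channel (p : Ω → ℝ) (X : Ω → Fin 4) :
    entropy p (fun ω => channel (X ω)) = entropy p X :=
  entropy_congr fun _ _ => channel_injective.eq_iff

lemma entropy_input_le (hp : p ∈ stdSimplex ℝ Ω) (X : Ω → Fin 4) :
    entropy p X ≤ 2 ∧ (2 ≤ entropy p X → IsUniform p X) := by
  have h := entropy_le_log_card hp.1 hp.2 X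
  have h4 : Real.log (Fintype.card (Fin 4)) / Real.log 2 = 2 := by
    rw [Fintype.card_fin, show ((4 : ℕ) : ℝ) = 2 ^ 2 by norm_num, Real.log_pow,
      mul_div_assoc, div_self log_two_pos.ne']
    norm_num
  rwa [h4] at h

/-- If `β` is a function of the output pair, then `I(W; β) + H(Y₁Y₂ | W) ≤ H(X)`, and equality
makes `W` and `X` conditionally independent given `β`. -/
lemma mutualInfo_add_condEntropy_le {β : Type*} [Fintype β] (hp : ∀ ω, 0 ≤ p ω) (W : Ω → 𝒲)
    (X : Ω → Fin 4) (f : Fin 4 → β) :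
    mutualInfo p W (fun ω => f (X ω)) + condEntropy p (fun ω => channel (X ω)) W
        ≤ entropy p X ∧
      (entropy p X ≤
          mutualInfo p W (fun ω => f (X ω)) + condEntropy p (fun ω => channel (X ω)) W →
        ∀ w x, law p (fun ω => (W ω, X ω)) (w, x) * law p (fun ω => f (X ω)) (f x)
          = law p (fun ω => (W ω, f (X ω))) (w, f x) * law p X x) := by
  obtain ⟨h1, h2⟩ := entropy_submodular hp W X (fun ω => f (X ω))
  have e1 : entropy p (fun ω => (X ω, f (X ω))) = entropy p X :=
    entropy_congr fun ω ω' => by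
      simp only [Prod.mk.injEq, and_iff_left_iff_imp]
      exact fun h => congrArg f h
  have e2 : entropy p (fun ω => (W ω, X ω, f (X ω)))
      = entropy p (fun ω => (channel (X ω), W ω)) :=
    entropy_congr fun ω ω' => by
      simp only [Prod.mk.injEq, channel_injective.eq_iff]
      exact ⟨fun h => ⟨h.2.1, h.1⟩, fun h => ⟨h.2, h.1, congrArg f h.1⟩⟩
  rw [e1, e2] at h1 h2
  simp only [mutualInfo, condEntropy]
  refine ⟨by linarith, fun hle w x => ?_⟩
  have h := h2 (by linarith) w x (f x)
  rw [law_congr (p := p) (Z' := fun ω => (W ω, X ω)) (z' := (w, x)) fun ω => by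
      simp only [Prod.mk.injEq]
      exact ⟨fun h => ⟨h.1, h.2.1⟩, fun h => ⟨h.1, h.2, congrArg f h.2⟩⟩] at h
  rw [h]
  congr 1
  exact law_congr fun ω => by
    simp only [Prod.mk.injEq, and_iff_left_iff_imp]
    exact fun h => congrArg f h

/-- The hypothesis forces equality in the preceding bound for both outputs. With `X` uniform, `P(w,
x)` then agrees on inputs sharing either output, and the chain 0-1-2-3 connects all inputs. -/
lemma uniform_independent_of_two_le (hp : p ∈ stdSimplex ℝ Ω) (W : Ω → 𝒲) (X : Ω → Fin 4)
    (h : 2 ≤ commonInfo channel p W X + condEntropy p (fun ω => channel (X ω)) W) :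
    IsUniform p X ∧ Independent p W (fun ω => channel (X ω)) := by
  obtain ⟨l1, h1⟩ := mutualInfo_add_condEntropy_le hp.1 W X fun x => (channel x).1
  obtain ⟨l2, h2⟩ := mutualInfo_add_condEntropy_le hp.1 W X fun x => (channel x).2
  obtain ⟨hX2, hXu⟩ := entropy_input_le hp X
  have m1 : commonInfo channel p W X ≤ _ := min_le_left _ _
  have m2 : commonInfo channel p W X ≤ _ := min_le_right _ _
  have hu := hXu (by linarith)
  refine ⟨hu, ?_⟩
  replace h1 := h1 (by linarith)
  replace h2 := h2 (by linarith)
  have hX : ∀ x, law p X x = 1 / 4 := fun x => by simpa using hu x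
  have hpos : ∀ {β : Type} [Fintype β] (f : Fin 4 → β) (x : Fin 4),
      law p (fun ω => f (X ω)) (f x) ≠ 0 := fun f x => by
    have : law p X x ≤ law p (fun ω => f (X ω)) (f x) :=
      law_mono hp.1 fun ω h => congrArg f h
    rw [hX] at this
    linarith
  have step : ∀ {β : Type} [Fintype β] (f : Fin 4 → β),
      (∀ w x, law p (fun ω => (W ω, X ω)) (w, x) * law p (fun ω => f (X ω)) (f x)
          = law p (fun ω => (W ω, f (X ω))) (w, f x) * law p X x) →
      ∀ w x x', f x = f x' →
        law p (fun ω => (W ω, X ω)) (w, x) = law p (fun ω => (W ω, X ω)) (w, x') := by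
    intro β _ f hf w x x' hxx
    have e := hf w x
    have e' := hf w x'
    rw [hX, hxx] at e
    rw [hX] at e'
    exact mul_right_cancel₀ (hpos f x') (e.trans e'.symm)
  have hconst : ∀ w x, law p (fun ω => (W ω, X ω)) (w, x) = law p W w * law p X x := by
    intro w x
    have e01 := step (fun x => (channel x).2) h2 w 0 1 rfl
    have e12 := step (fun x => (channel x).1) h1 w 1 2 rfl
    have e23 := step (fun x => (channel x).2) h2 w 2 3 rfl
    have hs : ∑ x, law p (fun ω => (W ω, X ω)) (w, x) = law p W w := by
      rw [← sum_law_pair p X W w]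
      exact Finset.sum_congr rfl fun x _ => law_congr fun ω => by
        simp only [Prod.mk.injEq, and_comm]
    rw [Fin.sum_univ_four] at hs
    rw [hX]
    fin_cases x <;> simp only [Fin.zero_eta, Fin.mk_one, Fin.reduceFinMk] <;> linarith
  intro w y
  by_cases hy : ∃ x, channel x = y
  · obtain ⟨x, rfl⟩ := hy
    rw [law_congr (Z' := X) (z' := x) fun ω => channel_injective.eq_iff, ← hconst]
    exact law_congr fun ω => by simp only [Prod.mk.injEq, channel_injective.eq_iff]
  · have e1 : law p (fun ω => channel (X ω)) y = 0 :=
      law_eq_zero fun ω h => hy ⟨_, h⟩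
    have e2 : law p (fun ω => (W ω, channel (X ω))) (w, y) = 0 :=
      law_eq_zero fun ω h => hy ⟨_, (Prod.mk.inj h).2⟩
    rw [e1, e2, mul_zero]

lemma mutualInfo_nonpos_of_independent {β : Type*} [Fintype β] (hp : p ∈ stdSimplex ℝ Ω)
    (W : Ω → 𝒲) (X : Ω → Fin 4) (f : Fin 4 → β)
    (h : Independent p W (fun ω => channel (X ω))) :
    mutualInfo p W (fun ω => f (X ω)) ≤ 0 := by
  have h1 := (mutualInfo_add_condEntropy_le hp.1 W X f).1
  have h2 := h.entropy_pair hp.2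
  have e : entropy p (fun ω => (channel (X ω), W ω)) = entropy p (fun ω => (W ω, channel (X ω))) :=
    entropy_congr fun ω ω' => by simp only [Prod.mk.injEq, and_comm]
  rw [entropy_channel] at h2
  simp only [condEntropy] at h1
  linarith

lemma commonInfo_nonpos_of_independent (hp : p ∈ stdSimplex ℝ Ω) (W : Ω → 𝒲) (X : Ω → Fin 4)
    (h : Independent p W (fun ω => channel (X ω))) : commonInfo channel p W X ≤ 0 :=
  (min_le_left _ _).trans
    (mutualInfo_nonpos_of_independent hp W X (fun x => (channel x).1) h)

lemma DetBounds.sum_rate_two (hp : p ∈ stdSimplex ℝ Ω) {W : Ω → 𝒲} {X : Ω → Fin 4}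
    {R₀ R₁ R₂ : ℝ} (h : DetBounds channel p W X R₀ R₁ R₂) (hsum : R₀ + R₁ + R₂ = 2) :
    IsUniform p X ∧ Independent p W (fun ω => channel (X ω)) ∧ R₀ = 0 := by
  obtain ⟨hu, hi⟩ := uniform_independent_of_two_le hp W X (hsum ▸ h.bound₃)
  exact ⟨hu, hi, le_antisymm (h.bound₀.trans (commonInfo_nonpos_of_independent hp W X hi))
    h.nonneg₀⟩

/-- The gap is the sum of `I(U; X | Y₁W)`, `I(V; UX | Y₂W)` and `H(X | UVW)`, all non-negative
(`s1`, `s2`, `s3`). -/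
lemma binning_le_condEntropy (hp : ∀ ω, 0 ≤ p ω) (W : Ω → 𝒲) (U : Ω → 𝒰) (V : Ω → 𝒱)
    (X : Ω → Fin 4) :
    condMutualInfo p U (fun ω => (channel (X ω)).1) W
      + condMutualInfo p V (fun ω => (channel (X ω)).2) W - condMutualInfo p U V W
      ≤ condEntropy p (fun ω => channel (X ω)) W := by
  have s1 := (entropy_submodular hp U X (fun ω => ((channel (X ω)).1, W ω))).1
  have s2 := (entropy_submodular hp V (fun ω => (U ω, X ω))
    (fun ω => ((channel (X ω)).2, W ω))).1
  have s3 := entropy_le_of_determines hp (Z := fun ω => (U ω, X ω, V ω, W ω))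
    (Z' := fun ω => (U ω, V ω, W ω)) fun ω ω' h => by
      simp only [Prod.mk.injEq] at h ⊢
      exact ⟨h.1, h.2.2⟩
  have e1 : entropy p (fun ω => (X ω, (channel (X ω)).1, W ω))
      = entropy p (fun ω => (channel (X ω), W ω)) := entropy_congr fun ω ω' => by
    simp only [Prod.mk.injEq, channel_injective.eq_iff]
    exact ⟨fun h => ⟨h.1, h.2.2⟩, fun h => ⟨h.1, by rw [h.1], h.2⟩⟩
  have e2 : entropy p (fun ω => (U ω, X ω, (channel (X ω)).1, W ω))
      = entropy p (fun ω => ((U ω, X ω), (channel (X ω)).2, W ω)) :=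
    entropy_congr fun ω ω' => by
      simp only [Prod.mk.injEq]
      exact ⟨fun h => ⟨⟨h.1, h.2.1⟩, by rw [h.2.1], h.2.2.2⟩,
        fun h => ⟨h.1.1, h.1.2, by rw [h.1.2], h.2.2⟩⟩
  have e3 : entropy p (fun ω => (V ω, (U ω, X ω), (channel (X ω)).2, W ω))
      = entropy p (fun ω => (U ω, X ω, V ω, W ω)) := entropy_congr fun ω ω' => by
    simp only [Prod.mk.injEq]
    exact ⟨fun h => ⟨h.2.1.1, h.2.1.2, h.1, h.2.2.2⟩,
      fun h => ⟨h.2.2.1, ⟨h.1, h.2.1⟩, by rw [h.2.1], h.2.2.2⟩⟩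
  simp only [condMutualInfo, condEntropy]
  linarith

lemma mutualInfo_pair_eq {α β : Type*} [Fintype α] [Fintype β] (W : Ω → 𝒲) (U : Ω → α)
    (Y : Ω → β) :
    mutualInfo p (fun ω => (W ω, U ω)) Y = mutualInfo p W Y + condMutualInfo p U Y W := by
  have e1 : entropy p (fun ω => (W ω, U ω)) = entropy p (fun ω => (U ω, W ω)) :=
    entropy_congr fun ω ω' => by simp only [Prod.mk.injEq, and_comm]
  have e2 : entropy p (fun ω => (W ω, Y ω)) = entropy p (fun ω => (Y ω, W ω)) :=
    entropy_congr fun ω ω' => by simp only [Prod.mk.injEq, and_comm]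
  have e3 : entropy p (fun ω => ((W ω, U ω), Y ω)) = entropy p (fun ω => (U ω, Y ω, W ω)) :=
    entropy_congr fun ω ω' => by
      simp only [Prod.mk.injEq]
      tauto
  simp only [mutualInfo, condMutualInfo, condEntropy]
  linarith

lemma HanCosta.sum_rate_two (hp : p ∈ stdSimplex ℝ Ω) {W : Ω → 𝒲} {U : Ω → 𝒰} {V : Ω → 𝒱}
    {X : Ω → Fin 4} {R₀ R₁ R₂ : ℝ} (h : HanCosta channel p W U V X R₀ R₁ R₂)
    (hsum : R₀ + R₁ + R₂ = 2) :
    IsUniform p X ∧ Independent p W (fun ω => channel (X ω)) ∧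
      (R₀ ≤ commonInfo channel p W X → R₀ = 0) ∧
      (2 * R₀ + R₁ + R₂ ≤ rhs₄ channel p W U V X → R₀ = 0) := by
  have hbin := binning_le_condEntropy hp.1 W U V X
  have hb := h.bound₃
  rw [rhs₃] at hb
  obtain ⟨hu, hi⟩ := uniform_independent_of_two_le hp W X (by linarith)
  refine ⟨hu, hi, fun ha => le_antisymm
    (ha.trans (commonInfo_nonpos_of_independent hp W X hi)) h.nonneg₀, fun hb4 => ?_⟩
  -- By the chain rule the right side is `I(W;Y₁) + I(W;Y₂)` plus the binning term, so at most `0 +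
  -- 0 + 2`, while the left side is `R₀ + 2`.
  rw [rhs₄, rhs₁, rhs₂, mutualInfo_pair_eq, mutualInfo_pair_eq] at hb4
  have n1 := mutualInfo_nonpos_of_independent hp W X (fun x => (channel x).1) hi
  have n2 := mutualInfo_nonpos_of_independent hp W X (fun x => (channel x).2) hi
  have hY : condEntropy p (fun ω => channel (X ω)) W ≤ 2 := by
    have e := hi.entropy_pair hp.2
    have e' : entropy p (fun ω => (channel (X ω), W ω))
        = entropy p (fun ω => (W ω, channel (X ω))) :=
      entropy_congr fun ω ω' => by simp only [Prod.mk.injEq, and_comm]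
    have h2 := (entropy_input_le hp X).1
    rw [entropy_channel] at e
    simp only [condEntropy]
    linarith
  have := h.nonneg₀
  linarith

end SumRate

/-! ### Uniform input attains `(1/2, 1, 1/2)` with constant `W`, `U = Y₁` and `V = Y₂` -/

lemma uniform_mem_stdSimplex : (fun _ => 1 / 4 : Fin 4 → ℝ) ∈ stdSimplex ℝ (Fin 4) :=
  ⟨fun _ => by norm_num, by simp⟩

lemma isUniform_uniform : IsUniform (fun _ => 1 / 4 : Fin 4 → ℝ) id := by
  classical
  intro z
  rw [law, Finset.sum_filter]
  simp

lemma entropy_uniform {α : Type*} [Fintype α] [DecidableEq α] (Z : Fin 4 → α) :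
    entropy (fun _ => 1 / 4) Z
      = -(∑ x, 1 / 4 * Real.log ((Finset.univ.filter fun x' => Z x' = Z x).card / 4))
        / Real.log 2 := by
  rw [entropy_eq_sum]
  congr! 4 with x
  rw [law, Finset.sum_const, nsmul_eq_mul, mul_one_div]
  congr!

/-- The three values are `H(Y₁)`, `H(Y₂)` and `H(Y₁) + H(Y₂) - I(Y₁;Y₂) = H(Y₁Y₂)`. -/
lemma rhs_uniform :
    rhs₁ channel (fun _ => 1 / 4) (fun _ => ()) (fun x => (channel x).1) id = 3 / 2 ∧
    rhs₂ channel (fun _ => 1 / 4) (fun _ => ()) (fun x => (channel x).2) id = 1 ∧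
    rhs₃ channel (fun _ => 1 / 4) (fun _ => ()) (fun x => (channel x).1)
      (fun x => (channel x).2) id = 2 := by
  set p : Fin 4 → ℝ := fun _ => 1 / 4
  have l4 : Real.log (1 / 4) = -(2 * Real.log 2) := by
    rw [one_div, Real.log_inv, show (4 : ℝ) = 2 ^ 2 by norm_num, Real.log_pow]
    norm_num
  have l2 : Real.log (2 / 4) = -Real.log 2 := by
    rw [← Real.log_inv]
    norm_num
  have hne := log_two_pos.ne'
  have H1 : entropy p (fun x => (channel x).1) = 3 / 2 := by
    rw [entropy_uniform, Fin.sum_univ_four,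
      show (Finset.univ.filter fun x' => (channel x').1 = (channel 0).1).card = 1 by decide,
      show (Finset.univ.filter fun x' => (channel x').1 = (channel 1).1).card = 2 by decide,
      show (Finset.univ.filter fun x' => (channel x').1 = (channel 2).1).card = 2 by decide,
      show (Finset.univ.filter fun x' => (channel x').1 = (channel 3).1).card = 1 by decide]
    push_cast
    rw [l4, l2]
    field_simp
    ring
  have H2 : entropy p (fun x => (channel x).2) = 1 := by
    rw [entropy_uniform, Fin.sum_univ_four,
      show (Finset.univ.filter fun x' => (channel x').2 = (channel 0).2).card = 2 by decide,
      show (Finset.univ.filter fun x' => (channel x').2 = (channel 1).2).card = 2 by decide,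
      show (Finset.univ.filter fun x' => (channel x').2 = (channel 2).2).card = 2 by decide,
      show (Finset.univ.filter fun x' => (channel x').2 = (channel 3).2).card = 2 by decide]
    push_cast
    rw [l2]
    field_simp
    ring
  have H : entropy p (fun x => ((channel x).1, (channel x).2)) = 2 := by
    rw [entropy_uniform, Fin.sum_univ_four,
      show (Finset.univ.filter fun x' =>
        ((channel x').1, (channel x').2) = ((channel 0).1, (channel 0).2)).card = 1 by decide,
      show (Finset.univ.filter fun x' =>
        ((channel x').1, (channel x').2) = ((channel 1).1, (channel 1).2)).card = 1 by decide,
      show (Finset.univ.filter fun x' =>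
        ((channel x').1, (channel x').2) = ((channel 2).1, (channel 2).2)).card = 1 by decide,
      show (Finset.univ.filter fun x' =>
        ((channel x').1, (channel x').2) = ((channel 3).1, (channel 3).2)).card = 1 by decide]
    push_cast
    rw [l4]
    field_simp
    ring
  have H0 : entropy p (fun _ => ()) = 0 := by
    rw [entropy_uniform]
    simp
  have r1 : ∀ {α : Type} [Fintype α] (Z : Fin 4 → α),
      entropy p (fun x => ((), Z x)) = entropy p Z := fun Z =>
    entropy_congr fun _ _ => by simp
  have r2 : ∀ {α : Type} [Fintype α] (Z : Fin 4 → α),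
      entropy p (fun x => (Z x, ())) = entropy p Z := fun Z =>
    entropy_congr fun _ _ => by simp
  have r3 : ∀ {α : Type} [Fintype α] (Z : Fin 4 → α),
      entropy p (fun x => (Z x, Z x, ())) = entropy p Z := fun Z =>
    entropy_congr fun _ _ => by simp
  have r4 : entropy p (fun x => ((channel x).1, (channel x).2, ()))
      = entropy p (fun x => ((channel x).1, (channel x).2)) :=
    entropy_congr fun _ _ => by simp only [Prod.mk.injEq, and_true]
  have r5 : ∀ {α : Type} [Fintype α] (Z : Fin 4 → α),
      entropy p (fun x => (((), Z x), Z x)) = entropy p Z := fun Z =>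
    entropy_congr fun _ _ => by simp
  simp only [rhs₁, rhs₂, rhs₃, commonInfo, mutualInfo, condMutualInfo, condEntropy, id, r1, r2,
    r3, r4, r5, H0, H1, H2, H]
  norm_num

end BroadcastExample

open BroadcastExample in
theorem mainTheorem4 :
    -- with uniform input, the Han–Costa inequalities permit (1/2, 1, 1/2)
    (∃ (Ω 𝒲 𝒰 𝒱 : Type) (_ : Fintype Ω) (_ : Fintype 𝒲) (_ : Fintype 𝒰) (_ : Fintype 𝒱)
        (p : Ω → ℝ) (W : Ω → 𝒲) (U : Ω → 𝒰) (V : Ω → 𝒱) (X : Ω → Fin 4),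
        p ∈ stdSimplex ℝ Ω ∧ IsUniform p X ∧ HanCosta channel p W U V X (1 / 2) 1 (1 / 2)) ∧
    -- this triple is not achievable
    ¬ Achievable channel (1 / 2) 1 (1 / 2) ∧
    -- slightly smaller triples satisfy the strict inequalities and are not achievable either
    (∃ δ : ℝ, 0 < δ ∧ ∀ ε : ℝ, 0 < ε → ε < δ →
      (∃ (Ω 𝒲 𝒰 𝒱 : Type) (_ : Fintype Ω) (_ : Fintype 𝒲) (_ : Fintype 𝒰) (_ : Fintype 𝒱)
        (p : Ω → ℝ) (W : Ω → 𝒲) (U : Ω → 𝒰) (V : Ω → 𝒱) (X : Ω → Fin 4),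
        p ∈ stdSimplex ℝ Ω ∧ IsUniform p X ∧
        HanCostaStrict channel p W U V X (1 / 2 - ε) (1 - ε) (1 / 2 - ε)) ∧
      ¬ Achievable channel (1 / 2 - ε) (1 - ε) (1 / 2 - ε)) ∧
    -- an achievable triple of sum rate 2 has no common rate
    (∀ R₀ R₁ R₂ : ℝ, Achievable channel R₀ R₁ R₂ → R₀ + R₁ + R₂ = 2 → R₀ = 0) ∧
    -- in the single-letter capacity region, sum rate 2 forces X uniform, W independent of Y₁Y₂,
    -- and R₀ = 0
    (∀ (Ω 𝒲 : Type) [Fintype Ω] [Fintype 𝒲] (p : Ω → ℝ) (W : Ω → 𝒲) (X : Ω → Fin 4)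
        (R₀ R₁ R₂ : ℝ),
        p ∈ stdSimplex ℝ Ω → DetBounds channel p W X R₀ R₁ R₂ → R₀ + R₁ + R₂ = 2 →
        IsUniform p X ∧ Independent p W (fun ω => channel (X ω)) ∧ R₀ = 0) ∧
    -- the same for the Han–Costa inequalities, where R₀ = 0 needs one of the two added bounds
    (∀ (Ω 𝒲 𝒰 𝒱 : Type) [Fintype Ω] [Fintype 𝒲] [Fintype 𝒰] [Fintype 𝒱]
        (p : Ω → ℝ) (W : Ω → 𝒲) (U : Ω → 𝒰) (V : Ω → 𝒱) (X : Ω → Fin 4) (R₀ R₁ R₂ : ℝ),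
        p ∈ stdSimplex ℝ Ω → HanCosta channel p W U V X R₀ R₁ R₂ → R₀ + R₁ + R₂ = 2 →
        IsUniform p X ∧ Independent p W (fun ω => channel (X ω)) ∧
        (R₀ ≤ commonInfo channel p W X → R₀ = 0) ∧
        (2 * R₀ + R₁ + R₂ ≤ rhs₄ channel p W U V X → R₀ = 0)) ∧
    -- adding either bound removes (1/2, 1, 1/2), whatever the auxiliaries and the input law
    (∀ (Ω 𝒲 𝒰 𝒱 : Type) [Fintype Ω] [Fintype 𝒲] [Fintype 𝒰] [Fintype 𝒱]
        (p : Ω → ℝ) (W : Ω → 𝒲) (U : Ω → 𝒰) (V : Ω → 𝒱) (X : Ω → Fin 4),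
        p ∈ stdSimplex ℝ Ω → HanCosta channel p W U V X (1 / 2) 1 (1 / 2) →
        ¬ (1 / 2 ≤ commonInfo channel p W X) ∧
        ¬ (2 * (1 / 2) + 1 + 1 / 2 ≤ rhs₄ channel p W U V X)) := by
  obtain ⟨h1, h2, h3⟩ := rhs_uniform
  refine ⟨⟨Fin 4, Unit, Fin 3, Fin 2, inferInstance, inferInstance, inferInstance, inferInstance,
      fun _ => 1 / 4, fun _ => (), fun x => (channel x).1, fun x => (channel x).2, id,
      uniform_mem_stdSimplex, isUniform_uniform, by norm_num, by norm_num, by norm_num,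
      by rw [h1]; norm_num, by rw [h2]; norm_num, by rw [h3]; norm_num⟩,
    fun h => by linarith [h.rate_bound],
    -- The shifted triple gives `12.5 - 19 ε` in the rate bound, which exceeds 12 exactly when `ε <
    -- 1 / 38`.
    ⟨1 / 38, by norm_num, fun ε hε hε' => ⟨⟨Fin 4, Unit, Fin 3, Fin 2, inferInstance,
      inferInstance, inferInstance, inferInstance, fun _ => 1 / 4, fun _ => (),
      fun x => (channel x).1, fun x => (channel x).2, id, uniform_mem_stdSimplex,
      isUniform_uniform, by linarith, by linarith, by linarith, by rw [h1]; linarith,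
      by rw [h2]; linarith, by rw [h3]; linarith⟩, fun h => by linarith [h.rate_bound]⟩⟩,
    fun R₀ R₁ R₂ h hsum => le_antisymm (by linarith [h.rate_bound]) h.1,
    fun Ω 𝒲 _ _ p W X R₀ R₁ R₂ hp h hsum => h.sum_rate_two hp hsum,
    fun Ω 𝒲 𝒰 𝒱 _ _ _ _ p W U V X R₀ R₁ R₂ hp h hsum => h.sum_rate_two hp hsum,
    fun Ω 𝒲 𝒰 𝒱 _ _ _ _ p W U V X hp h => ?_⟩
  obtain ⟨-, -, ha, hb⟩ := h.sum_rate_two hp (by norm_num)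
  exact ⟨fun h => by linarith [ha h], fun h => by linarith [hb h]⟩
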